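/- Let $m\ge 0$, $\ell,r\ge 1$ be integers and $k=\ell r$. For $h:\mathbb{F}_2^n\to\mathbb{Z}_{2^k}$ let $W_h(u)=\sum_{x\in\mathbb{F}_2^n}\zeta_{2^k}^{h(x)}(-1)^{\langle u,x\rangle}$ with $\zeta_{2^k}=e^{2\pi i/2^k}$. Call $h$ gbent if $|W_h(u)|=2^{n/2}$ for all $u\in\mathbb{F}_2^n$. Call $h$ landscape with set of levels $L$ if $L$ is a finite nonempty set of pairs $(a,v)$ with $a\in\mathbb{N}_0$ and $v\in\mathbb{N}$ odd such that $\{|W_h(u)| : W_h(u)\neq 0\}=\{2^{a/2}v : (a,v)\in L\}$. The $j$-th $2^\ell$-adic digit of an integer $N\ge 0$ is $\lfloor N/2^{j\ell}\rfloor \bmod 2^\ell\in\mathbb{Z}_{2^\ell}=\{0,\dots,2^\ell-1\}$; the $2^\ell$-adic components $c_0,\dots,c_{r-1}$ of a $\mathbb{Z}_{2^k}$-valued function $h$ are the digits of its representative in $\{0,\dots,2^k-1\}$. Put $h_\beta=c_{r-1}+\sum_{j=0}^{r-2}\beta_jc_j$, with values in $\mathbb{Z}_{2^\ell}$, for $\beta\in(\mathbb{Z}_{2^\ell})^{r-1}$.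 Let $\pi$ be a permutation of $\mathbb{F}_2^m$, $g:\mathbb{F}_2^m\to\mathbb{Z}_{2^k}$, $N(x,y)=\sum_{i=1}^m x_i\pi(y)_i\in\{0,\dots,m\}$ (bits read as integers), and let $f:\mathbb{F}_2^m\times\mathbb{F}_2^m=\mathbb{F}_2^{2m}\to\mathbb{Z}_{2^k}$, $f(x,y)=N(x,y)+g(y) \bmod 2^k$. Let $c_j$ and $g_j$ be the $2^\ell$-adic components of $f$ and $g$, and $\phi_j(x,y)$ the $j$-th $2^\ell$-adic digit of $N(x,y)$. (i) The $c_j$ are the unique functions $\mathbb{F}_2^{2m}\to\mathbb{Z}_{2^\ell}$ with $f=\sum_{j=0}^{r-1}2^{j\ell}c_j$, and likewise the $g_j$ for $g$. For $0\le j<r$, $c_j(x,y)$ is the $j$-th $2^\ell$-adic digit of the integer $N(x,y)+g(y)$ (with $g(y)\in\{0,\dots,2^k-1\}$), and $$c_j(x,y)\equiv \phi_j(x,y)+g_j(y)+e_j(x,y)\pmod{2^\ell},$$ where the carries are $e_0=0$ and $e_{j+1}=\left\lfloor\frac{\phi_j+g_j+e_j}{2^\ell}\right\rfloor$. For $j+1<r$,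 the formula $$c_{j+1}(x,y)\equiv\phi_{j+1}(x,y)+g_{j+1}(y)+\left\lfloor\frac{\phi_j(x,y)+g_j(y)}{2^\ell}\right\rfloor\pmod{2^\ell}$$ holds at $(x,y)$ if and only if it is not the case that both $e_j(x,y)=1$ and $\phi_j(x,y)+g_j(y)=2^\ell-1$. If $f$ is gbent, it holds for all $(x,y)$ and all such $j$. (ii) If $f$ is gbent, then there is a set $L$ such that $f$ is landscape with set of levels $L$ and, for every $\beta\in(\mathbb{Z}_{2^\ell})^{r-1}$, $f_\beta$ is landscape with the same set of levels $L$ and is gbent over $\mathbb{Z}_{2^\ell}$. More generally, the same holds for every gbent function $h:\mathbb{F}_2^{2m}\to\mathbb{Z}_{2^k}$ (not necessarily of the above form) and its derived functions $h_\beta$. -/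

import Mathlib

open scoped BigOperators

noncomputable section

/-- The character value `ζ_{2^k}^a = exp (2 π i a / 2^k)` for `a ∈ ℤ/2^k`. -/
def zetaPow (k : ℕ) (a : ZMod (2 ^ k)) : ℂ :=
  Complex.exp (2 * Real.pi * Complex.I * (a.val : ℂ) / (2 : ℂ) ^ k)

/-- The (unnormalized) Walsh-Hadamard transform of a generalized Boolean function
`f : 𝔽₂^ι → ℤ/2^k`. -/
def WHT {ι : Type} [Fintype ι] [DecidableEq ι] {k : ℕ}
    (f : (ι → ZMod 2) → ZMod (2 ^ k)) (u : ι → ZMod 2) : ℂ :=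
  ∑ x : ι → ZMod 2, zetaPow k (f x) * (-1 : ℂ) ^ (∑ i, u i * x i : ZMod 2).val

/-- `f : 𝔽₂^ι → ℤ/2^k` is generalized bent: `|W_f(u)| = 2^{n/2}` for all `u`, `n = |ι|`. -/
def IsGbent {ι : Type} [Fintype ι] [DecidableEq ι] {k : ℕ}
    (f : (ι → ZMod 2) → ZMod (2 ^ k)) : Prop :=
  ∀ u, ‖WHT f u‖ = (2 : ℝ) ^ ((Fintype.card ι : ℝ) / 2)

/-- `f` is landscape and `L` is its set of levels: `L` is a finite nonempty set of pairs `(m, v)`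
with `v` odd, and the set of nonzero Walsh magnitudes is `{2^{m/2} v | (m, v) ∈ L}`.
(As `2^{m/2} v` determines `(m, v)` for odd `v`, there is at most one such `L`.) -/
def IsLandscapeWithLevels {ι : Type} [Fintype ι] [DecidableEq ι] {k : ℕ}
    (f : (ι → ZMod 2) → ZMod (2 ^ k)) (L : Finset (ℕ × ℕ)) : Prop :=
  L.Nonempty ∧ (∀ p ∈ L, Odd p.2) ∧
    (fun u => ‖WHT f u‖) '' Function.support (WHT f) =
      (fun p : ℕ × ℕ => (2 : ℝ) ^ ((p.1 : ℝ) / 2) * (p.2 : ℝ)) '' (L : Set (ℕ × ℕ))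

/-- The `j`-th `2^ℓ`-adic digit of the natural number `N`, as an element of `ℤ/2^ℓ`. -/
def adicDigit (ℓ j N : ℕ) : ZMod (2 ^ ℓ) := ((N / 2 ^ (j * ℓ) : ℕ) : ZMod (2 ^ ℓ))

/-- The `j`-th `2^ℓ`-adic component of a `ℤ/2^k`-valued function. -/
def adicComponent {V : Type} {k : ℕ} (ℓ : ℕ) (f : V → ZMod (2 ^ k)) (j : ℕ) (z : V) :
    ZMod (2 ^ ℓ) :=
  adicDigit ℓ j (f z).val

/-- `f = ∑_{j < r} 2^{jℓ} c_j`, where `c_j` takes values in `ℤ/2^ℓ = {0, …, 2^ℓ - 1}`. -/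
def IsAdicDecomposition {V : Type} {k : ℕ} (ℓ r : ℕ) (f : V → ZMod (2 ^ k))
    (c : Fin r → V → ZMod (2 ^ ℓ)) : Prop :=
  ∀ z, f z = ∑ j : Fin r, (2 : ZMod (2 ^ k)) ^ ((j : ℕ) * ℓ) * ((c j z).val : ZMod (2 ^ k))

/-- The derived function `f_β = c_{r-1} + ∑_{j ≤ r-2} β_j c_j`. -/
def derivedFun {V : Type} {k : ℕ} (ℓ r : ℕ) (f : V → ZMod (2 ^ k))
    (β : Fin (r - 1) → ZMod (2 ^ ℓ)) (z : V) : ZMod (2 ^ ℓ) :=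
  adicComponent ℓ f (r - 1) z + ∑ j : Fin (r - 1), β j * adicComponent ℓ f j z

/-- Carries in the blockwise addition of two sequences of base-`2^ℓ` digits:
`e_0 = 0` and `e_{j+1} = ⌊(a_j + b_j + e_j) / 2^ℓ⌋`. -/
def blockCarry (ℓ : ℕ) (a b : ℕ → ZMod (2 ^ ℓ)) : ℕ → ℕ
  | 0 => 0
  | j + 1 => ((a j).val + (b j).val + blockCarry ℓ a b j) / 2 ^ ℓ

/-- The integer `N(x, y) = ∑ i, x_i π(y)_i`, bits being read as the integers `0` and `1`. -/
def mmInt {m : ℕ} (π : Equiv.Perm (Fin m → ZMod 2)) (x y : Fin m → ZMod 2) : ℕ :=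
  ∑ i, (x i).val * (π y i).val

/-- The binary-input Maiorana-McFarland-type function `f(x, y) = ⟨x, π(y)⟩ + g(y)` on
`𝔽₂^{2m}`; a point `z` of `𝔽₂^{2m}`, indexed by `Fin m ⊕ Fin m`, is the pair `(x, y)` of its
left and right halves. -/
def mmFun {m k : ℕ} (π : Equiv.Perm (Fin m → ZMod 2)) (g : (Fin m → ZMod 2) → ZMod (2 ^ k))
    (z : Fin m ⊕ Fin m → ZMod 2) : ZMod (2 ^ k) :=
  (mmInt π (fun i => z (Sum.inl i)) (fun i => z (Sum.inr i)) : ZMod (2 ^ k)) +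
    g (fun i => z (Sum.inr i))

end

/-! Write `k = ℓ * r`, `ζ` for the primitive `2^k`-th root of unity, `H = 2^(k-1)`. The digit
statements are schoolbook addition in base `2^ℓ`. Carries are 0 or 1, and dropping the incoming
carry changes the outgoing one exactly when that carry is 1 and the block sum is `2^ℓ - 1`. In the
gbent case there are no carries because the family degenerates. At `u = (0, v)` the Walsh sum is the
transform in `y` of `ζ^{g(y)} P(y)` with `P(y) = ∏ (1 + ζ^{π(y)_i})`, so Parseval forces `∑ |P(y)|²
= 4^m`. The point `π⁻¹(0)` already contributes `4^m`, and for `k ≥ 2`, `m ≥ 1` the point `π⁻¹(1)`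
adds something positive. Hence `m = 0` and `N = 0` (`eq_zero_of_isGbent_mmFun`). For derived
functions, a Walsh value is `∑ a_t ζ^t` with integers `a_t` and modulus `2^m`. As 2 is totally
ramified in `ℤ[ζ]` and its prime `1 - ζ` is conjugation-stable up to units, `2^m` divides the value
(`two_pow_dvd_of_mul_conj`); the quotient has modulus 1 and is a power `ζ^s`. Integer relations
among the powers come only from `ζ^{t+H} = -ζ^t`, so `a_t - a_{t+H}` is known, and replacing `ζ^t`
by any antiperiodic `F(t)` turns the value into `2^m F(s)` (`norm_sum_antiperiodic`). Adding `H`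
alters only the top digit, by `2^(ℓ-1)`, and that digit has coefficient 1 in `h_β`; so `h_β` is
again gbent, with the single level `(2m, 1)`. -/

/-! ### Digits in base `2^ℓ` -/

theorem Nat.sum_pow_mul_digit (ℓ r n : ℕ) :
    ∑ j ∈ Finset.range r, 2 ^ (j * ℓ) * (n / 2 ^ (j * ℓ) % 2 ^ ℓ) = n % 2 ^ (r * ℓ) := by
  induction r with
  | zero => simp [Nat.mod_one]
  | succ r ih => rw [Finset.sum_range_succ, ih, Nat.succ_mul, pow_add, Nat.mod_mul]

theorem Nat.mod_two_pow_div_mod (ℓ j r n : ℕ) (hj : j < r) :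
    n % 2 ^ (ℓ * r) / 2 ^ (j * ℓ) % 2 ^ ℓ = n / 2 ^ (j * ℓ) % 2 ^ ℓ := by
  obtain ⟨d, rfl⟩ : ∃ d, r = j + 1 + d := ⟨r - (j + 1), by omega⟩
  have : 2 ^ (ℓ * (j + 1 + d)) = 2 ^ (j * ℓ) * (2 ^ ℓ * 2 ^ (ℓ * d)) := by
    rw [← pow_add, ← pow_add]; congr 1; ring
  rw [this, Nat.mod_mul_right_div_self, Nat.mod_mod_of_dvd _ (Dvd.intro _ rfl)]

theorem Nat.sum_pow_mul_lt (ℓ r : ℕ) (d : ℕ → ℕ) (hd : ∀ i, d i < 2 ^ ℓ) :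
    ∑ i ∈ Finset.range r, 2 ^ (i * ℓ) * d i < 2 ^ (r * ℓ) := by
  induction r with
  | zero => simp
  | succ r ih =>
    rw [Finset.sum_range_succ, Nat.succ_mul, pow_add]
    have := Nat.mul_le_mul_left (2 ^ (r * ℓ)) (Nat.succ_le_of_lt (hd r))
    rw [Nat.mul_succ] at this
    omega

theorem Nat.digit_sum_pow_mul (ℓ r : ℕ) (d : ℕ → ℕ) (hd : ∀ i, d i < 2 ^ ℓ) (j : ℕ)
    (hj : j < r) :
    (∑ i ∈ Finset.range r, 2 ^ (i * ℓ) * d i) / 2 ^ (j * ℓ) % 2 ^ ℓ = d j := by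
  induction r with
  | zero => omega
  | succ r ih =>
    rw [Finset.sum_range_succ]
    rcases Nat.lt_succ_iff_lt_or_eq.1 hj with h | rfl
    · rw [← Nat.mod_two_pow_div_mod ℓ j r _ h, mul_comm ℓ r, Nat.add_mul_mod_self_left,
        mul_comm r ℓ, Nat.mod_two_pow_div_mod ℓ j r _ h, ih h]
    · rw [Nat.add_mul_div_left _ _ (by positivity),
        Nat.div_eq_of_lt (Nat.sum_pow_mul_lt ℓ j d hd), zero_add, Nat.mod_eq_of_lt (hd j)]

theorem adicDigit_val (ℓ j N : ℕ) : (adicDigit ℓ j N).val = N / 2 ^ (j * ℓ) % 2 ^ ℓ :=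
  ZMod.val_natCast _ _

theorem adicDigit_mod (ℓ r j N : ℕ) (hj : j < r) :
    adicDigit ℓ j (N % 2 ^ (ℓ * r)) = adicDigit ℓ j N :=
  (ZMod.natCast_eq_natCast_iff' _ _ _).2 (Nat.mod_two_pow_div_mod ℓ j r N hj)

/-- The components form a decomposition. -/
theorem isAdicDecomposition_adicComponent {V : Type} (ℓ r : ℕ) (f : V → ZMod (2 ^ (ℓ * r))) :
    IsAdicDecomposition ℓ r f (fun j => adicComponent ℓ f j) := by
  intro z
  have h := Nat.sum_pow_mul_digit ℓ r (f z).val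
  rw [mul_comm r ℓ, Nat.mod_eq_of_lt (ZMod.val_lt _)] at h
  conv_lhs => rw [← ZMod.natCast_zmod_val (f z), ← h, ← Fin.sum_univ_eq_sum_range
    (fun j => 2 ^ (j * ℓ) * ((f z).val / 2 ^ (j * ℓ) % 2 ^ ℓ))]
  simp [adicComponent, adicDigit_val]

/-- The decomposition into components is unique. -/
theorem IsAdicDecomposition.eq_adicComponent {V : Type} {ℓ r : ℕ} {f : V → ZMod (2 ^ (ℓ * r))}
    {c : Fin r → V → ZMod (2 ^ ℓ)} (hc : IsAdicDecomposition ℓ r f c) :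
    c = fun j : Fin r => adicComponent ℓ f j := by
  funext j z
  -- Padding by zero beyond `r` is harmless: only digits of index below `r` are read.
  let d : ℕ → ℕ := fun i => if h : i < r then (c ⟨i, h⟩ z).val else 0
  have hd : ∀ i, d i < 2 ^ ℓ := by
    intro i
    by_cases h : i < r
    · simpa [d, h] using ZMod.val_lt (c ⟨i, h⟩ z)
    · simp [d, h]
  have hf : f z = ((∑ i ∈ Finset.range r, 2 ^ (i * ℓ) * d i : ℕ) : ZMod (2 ^ (ℓ * r))) := by
    rw [hc z, ← Fin.sum_univ_eq_sum_range (fun i => 2 ^ (i * ℓ) * d i)]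
    simp [d]
  apply ZMod.val_injective
  rw [adicComponent, hf, ZMod.val_natCast, adicDigit_mod _ _ _ _ j.2, adicDigit_val,
    Nat.digit_sum_pow_mul ℓ r d hd j j.2]
  simp [d]

/-! ### Carries in blockwise addition -/

/-- The carry is the defect of additivity of the floor; each further division by `2^ℓ` splits off
the current digits, which together with the old carry produce the new one. -/
theorem add_div_two_pow_eq_add_blockCarry (ℓ A G j : ℕ) :
    (A + G) / 2 ^ (j * ℓ) = A / 2 ^ (j * ℓ) + G / 2 ^ (j * ℓ) +
      blockCarry ℓ (fun i => adicDigit ℓ i A) (fun i => adicDigit ℓ i G) j := by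
  induction j with
  | zero => simp [blockCarry]
  | succ j ih =>
    rw [Nat.succ_mul, pow_add, ← Nat.div_div_eq_div_mul, ih, ← Nat.div_div_eq_div_mul,
      ← Nat.div_div_eq_div_mul, blockCarry, adicDigit_val, adicDigit_val]
    generalize blockCarry ℓ _ _ j = e
    generalize A / 2 ^ (j * ℓ) = a
    generalize G / 2 ^ (j * ℓ) = b
    have hB : 0 < 2 ^ ℓ := by positivity
    generalize 2 ^ ℓ = B at *
    conv_lhs => rw [← Nat.div_add_mod a B, ← Nat.div_add_mod b B]
    rw [show B * (a / B) + a % B + (B * (b / B) + b % B) + e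
      = a % B + b % B + e + B * (a / B + b / B) by ring, Nat.add_mul_div_left _ _ hB]
    ring

theorem adicDigit_add (ℓ A G j : ℕ) :
    adicDigit ℓ j (A + G) = adicDigit ℓ j A + adicDigit ℓ j G +
      (blockCarry ℓ (fun i => adicDigit ℓ i A) (fun i => adicDigit ℓ i G) j : ZMod (2 ^ ℓ)) := by
  simp only [adicDigit]
  rw [add_div_two_pow_eq_add_blockCarry]
  push_cast
  rfl

theorem blockCarry_le_one (ℓ : ℕ) (a b : ℕ → ZMod (2 ^ ℓ)) (j : ℕ) : blockCarry ℓ a b j ≤ 1 := by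
  induction j with
  | zero => simp [blockCarry]
  | succ j ih =>
    rw [blockCarry]
    have ha := ZMod.val_lt (a j)
    have hb := ZMod.val_lt (b j)
    rw [← Nat.lt_succ_iff, Nat.div_lt_iff_lt_mul (by positivity)]
    omega

/-- The carry out of a block is determined by the block alone unless a carry runs through it. -/
theorem cast_div_eq_cast_blockCarry_succ_iff (ℓ : ℕ) (hℓ : 1 ≤ ℓ) (a b : ℕ → ZMod (2 ^ ℓ))
    (j : ℕ) :
    ((blockCarry ℓ a b (j + 1) : ℕ) : ZMod (2 ^ ℓ)) =
        ((((a j).val + (b j).val) / 2 ^ ℓ : ℕ) : ZMod (2 ^ ℓ)) ↔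
      ¬ (blockCarry ℓ a b j = 1 ∧ (a j).val + (b j).val = 2 ^ ℓ - 1) := by
  -- Makes 0 and 1 distinct in `ZMod (2 ^ ℓ)`, so that comparing the casts compares the carries
  -- themselves.
  have hB : 2 ≤ 2 ^ ℓ := by
    calc 2 = 2 ^ 1 := rfl
      _ ≤ 2 ^ ℓ := Nat.pow_le_pow_right (by norm_num) hℓ
  have ha := ZMod.val_lt (a j)
  have hb := ZMod.val_lt (b j)
  have he := blockCarry_le_one ℓ a b j
  have h1 := blockCarry_le_one ℓ a b (j + 1)
  have h2 : ((a j).val + (b j).val) / 2 ^ ℓ ≤ 1 := by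
    rw [← Nat.lt_succ_iff, Nat.div_lt_iff_lt_mul (by positivity)]
    omega
  rw [ZMod.natCast_eq_natCast_iff', Nat.mod_eq_of_lt (by omega), Nat.mod_eq_of_lt (by omega),
    blockCarry]
  clear h1
  generalize (a j).val = p at *
  generalize (b j).val = q at *
  generalize blockCarry ℓ a b j = e at *
  clear a b
  generalize 2 ^ ℓ = B at *
  have hcase : ∀ n, n < 2 * B → n / B = if n < B then 0 else 1 := by
    intro n hn
    split_ifs with h
    · exact Nat.div_eq_of_lt h
    · exact Nat.div_eq_of_lt_le (by rw [one_mul]; omega) (by omega)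
  rw [hcase _ (by omega), hcase _ (by omega)]
  split_ifs <;> simp only [true_iff, false_iff, not_not] <;> omega

theorem blockCarry_zero_left (ℓ : ℕ) (b : ℕ → ZMod (2 ^ ℓ)) (j : ℕ) :
    blockCarry ℓ (fun _ => 0) b j = 0 := by
  induction j with
  | zero => rfl
  | succ j ih =>
    rw [blockCarry, ih]
    exact Nat.div_eq_of_lt (by simpa using ZMod.val_lt (b j))

theorem adicComponent_mmFun {m ℓ r : ℕ} (π : Equiv.Perm (Fin m → ZMod 2))
    (g : (Fin m → ZMod 2) → ZMod (2 ^ (ℓ * r))) (j : ℕ) (hj : j < r) (x y : Fin m → ZMod 2) :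
    adicComponent ℓ (mmFun π g) j (Sum.elim x y) =
      adicDigit ℓ j (mmInt π x y + (g y).val) := by
  have : mmFun π g (Sum.elim x y) =
      ((mmInt π x y + (g y).val : ℕ) : ZMod (2 ^ (ℓ * r))) := by
    simp [mmFun]
  rw [adicComponent, this, ZMod.val_natCast, adicDigit_mod _ _ _ _ hj]

/-! ### Effect of adding `2^(k-1)` on the digits -/

/-- Below the top block, `2^(ℓ r - 1)` is a multiple of `2^((j+1) ℓ)`. -/
theorem adicDigit_add_two_pow_of_lt (ℓ r j N : ℕ) (hℓ : 1 ≤ ℓ) (hj : j + 1 < r) :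
    adicDigit ℓ j (N + 2 ^ (ℓ * r - 1)) = adicDigit ℓ j N := by
  obtain ⟨d, rfl⟩ : ∃ d, r = j + 2 + d := ⟨r - (j + 2), by omega⟩
  obtain ⟨p, rfl⟩ : ∃ p, ℓ = p + 1 := ⟨ℓ - 1, by omega⟩
  have : 2 ^ ((p + 1) * (j + 2 + d) - 1) =
      2 ^ (j * (p + 1)) * (2 ^ (p + 1) * 2 ^ (p + (p + 1) * d)) := by
    rw [← pow_add, ← pow_add]
    congr 1
    rw [show (p + 1) * (j + 2 + d) = (j * (p + 1) + (p + 1 + (p + (p + 1) * d))) + 1 by ring]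
    rfl
  rw [adicDigit, adicDigit, this, Nat.add_mul_div_left _ _ (by positivity), Nat.cast_add,
    Nat.cast_mul, ZMod.natCast_self, zero_mul, add_zero]

theorem adicDigit_add_two_pow_top (ℓ r N : ℕ) (hℓ : 1 ≤ ℓ) (hr : 1 ≤ r) :
    adicDigit ℓ (r - 1) (N + 2 ^ (ℓ * r - 1)) =
      adicDigit ℓ (r - 1) N + ((2 ^ (ℓ - 1) : ℕ) : ZMod (2 ^ ℓ)) := by
  obtain ⟨q, rfl⟩ : ∃ q, r = q + 1 := ⟨r - 1, by omega⟩
  obtain ⟨p, rfl⟩ : ∃ p, ℓ = p + 1 := ⟨ℓ - 1, by omega⟩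
  have : 2 ^ ((p + 1) * (q + 1) - 1) = 2 ^ (q * (p + 1)) * 2 ^ p := by
    rw [← pow_add]
    congr 1
    rw [show (p + 1) * (q + 1) = q * (p + 1) + p + 1 by ring]
    rfl
  rw [adicDigit, adicDigit, this]
  simp only [Nat.add_sub_cancel]
  rw [Nat.add_mul_div_left _ _ (by positivity), Nat.cast_add]

/-- Adding `2^{k-1}` to the argument adds `2^{ℓ-1}` to every derived function. -/
theorem derivedFun_id_add_half (ℓ r : ℕ) (hℓ : 1 ≤ ℓ) (hr : 1 ≤ r)
    (β : Fin (r - 1) → ZMod (2 ^ ℓ)) (t : ZMod (2 ^ (ℓ * r))) :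
    derivedFun ℓ r (id : ZMod (2 ^ (ℓ * r)) → ZMod (2 ^ (ℓ * r))) β
        (t + ((2 ^ (ℓ * r - 1) : ℕ) : ZMod (2 ^ (ℓ * r)))) =
      derivedFun ℓ r id β t + ((2 ^ (ℓ - 1) : ℕ) : ZMod (2 ^ ℓ)) := by
  have hdig : ∀ j < r, adicComponent ℓ (id : ZMod (2 ^ (ℓ * r)) → ZMod (2 ^ (ℓ * r))) j
      (t + ((2 ^ (ℓ * r - 1) : ℕ) : ZMod (2 ^ (ℓ * r)))) =
      adicDigit ℓ j (t.val + 2 ^ (ℓ * r - 1)) := by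
    intro j hj
    have : t + ((2 ^ (ℓ * r - 1) : ℕ) : ZMod (2 ^ (ℓ * r))) =
        ((t.val + 2 ^ (ℓ * r - 1) : ℕ) : ZMod (2 ^ (ℓ * r))) := by
      rw [Nat.cast_add, ZMod.natCast_zmod_val]
    rw [adicComponent, id, this, ZMod.val_natCast, adicDigit_mod _ _ _ _ hj]
  rw [derivedFun, derivedFun, hdig _ (by omega), adicDigit_add_two_pow_top _ _ _ hℓ hr,
    Finset.sum_congr rfl fun j _ => by
      rw [hdig j (by omega), adicDigit_add_two_pow_of_lt _ _ _ _ hℓ (by omega)]]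
  simp only [adicComponent, id]
  ring

/-! ### Roots of unity and the half turn -/

theorem zetaPow_eq_stdAddChar (k : ℕ) (a : ZMod (2 ^ k)) : zetaPow k a = ZMod.stdAddChar a := by
  rw [ZMod.stdAddChar_apply, ZMod.toCircle_apply, zetaPow]
  push_cast
  rfl

theorem zetaPow_add (k : ℕ) (a b : ZMod (2 ^ k)) :
    zetaPow k (a + b) = zetaPow k a * zetaPow k b := by
  simp only [zetaPow_eq_stdAddChar, AddChar.map_add_eq_mul]

theorem zetaPow_zero (k : ℕ) : zetaPow k 0 = 1 := by
  rw [zetaPow_eq_stdAddChar, AddChar.map_zero_eq_one]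

theorem conj_zetaPow (k : ℕ) (a : ZMod (2 ^ k)) :
    (starRingEnd ℂ) (zetaPow k a) = zetaPow k (-a) := by
  rw [zetaPow_eq_stdAddChar, zetaPow_eq_stdAddChar, AddChar.map_neg_eq_conj]

theorem norm_zetaPow (k : ℕ) (a : ZMod (2 ^ k)) : ‖zetaPow k a‖ = 1 := by
  rw [zetaPow_eq_stdAddChar, AddChar.norm_apply]

theorem zetaPow_natCast (k n : ℕ) : zetaPow k (n : ZMod (2 ^ k)) = zetaPow k 1 ^ n := by
  rw [zetaPow_eq_stdAddChar, zetaPow_eq_stdAddChar, ← AddChar.map_nsmul_eq_pow, nsmul_one]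

theorem zetaPow_one (k : ℕ) :
    zetaPow k 1 = Complex.exp (2 * Real.pi * Complex.I / ((2 ^ k : ℕ) : ℂ)) := by
  have h := ZMod.toCircle_natCast (N := 2 ^ k) 1
  rw [zetaPow_eq_stdAddChar, ZMod.stdAddChar_apply]
  simpa using h

theorem isPrimitiveRoot_zetaPow_one (k : ℕ) : IsPrimitiveRoot (zetaPow k 1) (2 ^ k) := by
  rw [zetaPow_one]
  exact Complex.isPrimitiveRoot_exp _ (by positivity)

/-- The element `2^{k-1}` of order two in `ℤ/2^k`. -/
def halfTurn (k : ℕ) : ZMod (2 ^ k) := ((2 ^ (k - 1) : ℕ) : ZMod (2 ^ k))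

theorem halfTurn_add_self (k : ℕ) (hk : 1 ≤ k) : halfTurn k + halfTurn k = 0 := by
  obtain ⟨p, rfl⟩ : ∃ p, k = p + 1 := ⟨k - 1, by omega⟩
  rw [halfTurn, ← Nat.cast_add, Nat.add_sub_cancel, ← two_mul, ← pow_succ', ZMod.natCast_self]

theorem neg_halfTurn (k : ℕ) (hk : 1 ≤ k) : -halfTurn k = halfTurn k :=
  neg_eq_of_add_eq_zero_left (halfTurn_add_self k hk)

theorem halfTurn_ne_zero (k : ℕ) (hk : 1 ≤ k) : halfTurn k ≠ 0 := by
  rw [halfTurn, Ne, ZMod.natCast_eq_zero_iff]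
  intro h
  have := (Nat.pow_dvd_pow_iff_le_right (by norm_num : 1 < 2)).1 h
  omega

theorem zetaPow_halfTurn (k : ℕ) (hk : 1 ≤ k) : zetaPow k (halfTurn k) = -1 := by
  have h : zetaPow k (halfTurn k) ^ 2 = 1 := by
    rw [sq, ← zetaPow_add, halfTurn_add_self k hk, zetaPow_zero]
  refine (sq_eq_sq_iff_eq_or_eq_neg.1 (h.trans (one_pow 2).symm)).resolve_left ?_
  rw [← zetaPow_zero k, zetaPow_eq_stdAddChar, zetaPow_eq_stdAddChar]
  exact fun h => halfTurn_ne_zero k hk (ZMod.injective_stdAddChar h)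

theorem zetaPow_add_halfTurn (k : ℕ) (hk : 1 ≤ k) (a : ZMod (2 ^ k)) :
    zetaPow k (a + halfTurn k) = -zetaPow k a := by
  rw [zetaPow_add, zetaPow_halfTurn k hk, mul_neg_one]

theorem ZMod.sum_eq_sum_range_val {M : Type*} [AddCommMonoid M] (n : ℕ) [NeZero n]
    (f : ZMod n → M) : ∑ t, f t = ∑ i ∈ Finset.range n, f (i : ZMod n) := by
  symm
  refine Finset.sum_bij' (fun i _ => (i : ZMod n)) (fun t _ => t.val) ?_ ?_ ?_ ?_ ?_
  · simp
  · intro t _; simpa using ZMod.val_lt t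
  · intro i hi; exact ZMod.val_cast_of_lt (Finset.mem_range.1 hi)
  · intro t _; exact ZMod.natCast_zmod_val t
  · simp

/-- Half of `ℤ/2^k` represents the cosets of `{0, 2^{k-1}}`. -/
theorem sum_eq_sum_range_half {M : Type*} [AddCommMonoid M] (k : ℕ) (hk : 1 ≤ k)
    (f : ZMod (2 ^ k) → M) :
    ∑ t, f t = ∑ i ∈ Finset.range (2 ^ (k - 1)),
      (f (i : ZMod (2 ^ k)) + f ((i : ZMod (2 ^ k)) + halfTurn k)) := by
  rw [ZMod.sum_eq_sum_range_val, Finset.sum_add_distrib]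
  have : 2 ^ k = 2 ^ (k - 1) + 2 ^ (k - 1) := by
    rw [← two_mul, ← pow_succ', Nat.sub_add_cancel hk]
  rw [show Finset.range (2 ^ k) = Finset.range (2 ^ (k - 1) + 2 ^ (k - 1)) by rw [← this],
    Finset.sum_range_add]
  congr 1
  refine Finset.sum_congr rfl fun i _ => ?_
  rw [Nat.cast_add, add_comm, halfTurn]

/-! ### Cyclotomic integers and their coefficients -/

/-- The cyclotomic integer `∑ a_t ζ^t`. -/
noncomputable def cycSum (k : ℕ) (a : ZMod (2 ^ k) → ℤ) : ℂ := ∑ t, (a t : ℂ) * zetaPow k t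

theorem cycSum_eq_range (k : ℕ) (hk : 1 ≤ k) (a : ZMod (2 ^ k) → ℤ) :
    cycSum k a = ∑ i ∈ Finset.range (2 ^ (k - 1)),
      ((a (i : ZMod (2 ^ k)) - a ((i : ZMod (2 ^ k)) + halfTurn k) : ℤ) : ℂ) *
        zetaPow k 1 ^ i := by
  rw [cycSum, sum_eq_sum_range_half k hk]
  refine Finset.sum_congr rfl fun i _ => ?_
  rw [zetaPow_add_halfTurn k hk, zetaPow_natCast]
  push_cast
  ring

/-- Over the integers the powers of `ζ` only satisfy the relations `ζ^{t + 2^{k-1}} = -ζ^t`. -/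
theorem eq_add_halfTurn_of_cycSum_eq_zero (k : ℕ) (hk : 1 ≤ k) (a : ZMod (2 ^ k) → ℤ)
    (h : cycSum k a = 0) (t : ZMod (2 ^ k)) : a t = a (t + halfTurn k) := by
  -- The degree is `φ(2^k) = 2^(k-1)`, so the powers of `ζ` over half a period are independent over
  -- `ℚ`.
  have hdeg : (minpoly ℚ (zetaPow k 1)).natDegree = 2 ^ (k - 1) := by
    rw [← Polynomial.cyclotomic_eq_minpoly_rat (isPrimitiveRoot_zetaPow_one k) (by positivity),
      Polynomial.natDegree_cyclotomic, Nat.totient_prime_pow Nat.prime_two hk]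
    simp
  have hli := linearIndependent_pow (K := ℚ) (zetaPow k 1)
  rw [hdeg, Fintype.linearIndependent_iff] at hli
  have key : ∀ i : ℕ, i < 2 ^ (k - 1) →
      a (i : ZMod (2 ^ k)) = a ((i : ZMod (2 ^ k)) + halfTurn k) := by
    intro i hi
    have := hli (fun i => ((a (i : ZMod (2 ^ k)) - a ((i : ZMod (2 ^ k)) + halfTurn k) : ℤ) : ℚ))
      (by
        rw [← h, cycSum_eq_range k hk, ← Fin.sum_univ_eq_sum_range
          (fun i => ((a (i : ZMod (2 ^ k)) - a ((i : ZMod (2 ^ k)) + halfTurn k) : ℤ) : ℂ) *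
            zetaPow k 1 ^ i)]
        refine Finset.sum_congr rfl fun i _ => ?_
        rw [Rat.smul_def]
        push_cast
        rfl) ⟨i, hi⟩
    have h0 : a (i : ZMod (2 ^ k)) - a ((i : ZMod (2 ^ k)) + halfTurn k) = 0 := by
      exact_mod_cast this
    omega
  rcases lt_or_ge t.val (2 ^ (k - 1)) with ht | ht
  · simpa using key _ ht
  · have hlt := ZMod.val_lt t
    have h2 : 2 ^ k = 2 ^ (k - 1) + 2 ^ (k - 1) := by
      rw [← two_mul, ← pow_succ', Nat.sub_add_cancel hk]
    have := key (t.val - 2 ^ (k - 1)) (by omega)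
    have hc : ((t.val - 2 ^ (k - 1) : ℕ) : ZMod (2 ^ k)) = t + halfTurn k := by
      rw [Nat.cast_sub ht, ZMod.natCast_zmod_val, ← neg_halfTurn k hk, sub_eq_add_neg]
      rfl
    rw [hc, add_assoc, halfTurn_add_self k hk, add_zero] at this
    exact this.symm

theorem cycSum_sub (k : ℕ) (a b : ZMod (2 ^ k) → ℤ) :
    cycSum k (a - b) = cycSum k a - cycSum k b := by
  simp [cycSum, sub_mul, Finset.sum_sub_distrib]

theorem sub_eq_sub_of_cycSum_eq (k : ℕ) (hk : 1 ≤ k) (a b : ZMod (2 ^ k) → ℤ)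
    (h : cycSum k a = cycSum k b) (t : ZMod (2 ^ k)) :
    a t - a (t + halfTurn k) = b t - b (t + halfTurn k) := by
  have := eq_add_halfTurn_of_cycSum_eq_zero k hk (a - b) (by rw [cycSum_sub, h, sub_self]) t
  simp only [Pi.sub_apply] at this
  omega

theorem cycSum_mul (k : ℕ) (a b : ZMod (2 ^ k) → ℤ) :
    cycSum k a * cycSum k b = cycSum k (fun d => ∑ t, a (d - t) * b t) := by
  simp only [cycSum]
  push_cast
  simp_rw [Finset.sum_mul]
  rw [Finset.sum_comm, ← Finset.sum_mul, Finset.mul_sum]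
  refine Finset.sum_congr rfl fun t _ => ?_
  rw [Finset.sum_mul, ← Equiv.sum_comp (Equiv.subRight t)]
  refine Finset.sum_congr rfl fun s _ => ?_
  obtain ⟨s, rfl⟩ : ∃ s', s = s' + t := ⟨s - t, (sub_add_cancel s t).symm⟩
  simp only [Equiv.subRight_apply, add_sub_cancel_right]
  rw [zetaPow_add]
  ring

theorem conj_cycSum (k : ℕ) (a : ZMod (2 ^ k) → ℤ) :
    (starRingEnd ℂ) (cycSum k a) = cycSum k (fun t => a (-t)) := by
  rw [cycSum, map_sum, cycSum, ← Equiv.sum_comp (Equiv.neg (ZMod (2 ^ k)))]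
  simp [conj_zetaPow]

theorem cycSum_single (k : ℕ) (s : ZMod (2 ^ k)) (n : ℤ) :
    cycSum k (Pi.single s n) = n * zetaPow k s := by
  rw [cycSum, Finset.sum_eq_single s]
  · simp
  · intro t _ h; simp [Pi.single_eq_of_ne h]
  · simp

/-! ### Ramification of 2 in `ℤ[ζ]` -/

/-- The ring `ℤ[ζ]`, as the set of the `∑ a_t ζ^t`. -/
noncomputable def cycRing (k : ℕ) : Subring ℂ where
  carrier := Set.range (cycSum k)
  mul_mem' := by
    rintro _ _ ⟨a, rfl⟩ ⟨b, rfl⟩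
    exact ⟨_, (cycSum_mul k a b).symm⟩
  one_mem' := ⟨Pi.single 0 1, by rw [cycSum_single, zetaPow_zero]; simp⟩
  add_mem' := by
    rintro _ _ ⟨a, rfl⟩ ⟨b, rfl⟩
    exact ⟨a + b, by simp [cycSum, add_mul, Finset.sum_add_distrib]⟩
  zero_mem' := ⟨0, by simp [cycSum]⟩
  neg_mem' := by
    rintro _ ⟨a, rfl⟩
    exact ⟨-a, by simp [cycSum]⟩

/-- Complex conjugation on `ℤ[ζ]`. -/
noncomputable def cycConj (k : ℕ) : cycRing k →+* cycRing k :=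
  (starRingEnd ℂ).restrict (cycRing k) (cycRing k) (by
    rintro _ ⟨a, rfl⟩
    exact ⟨_, (conj_cycSum k a).symm⟩)

/-- The power `ζ^t` in `ℤ[ζ]`. -/
noncomputable def cycZeta (k : ℕ) (t : ZMod (2 ^ k)) : cycRing k :=
  ⟨zetaPow k t, Pi.single t 1, by rw [cycSum_single]; simp⟩

theorem cycZeta_add (k : ℕ) (s t : ZMod (2 ^ k)) :
    cycZeta k (s + t) = cycZeta k s * cycZeta k t := Subtype.ext (zetaPow_add k s t)

theorem cycZeta_natCast (k n : ℕ) : cycZeta k (n : ZMod (2 ^ k)) = cycZeta k 1 ^ n :=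
  Subtype.ext (by simpa [cycZeta] using zetaPow_natCast k n)

theorem cycZeta_halfTurn (k : ℕ) (hk : 1 ≤ k) : cycZeta k (halfTurn k) = -1 :=
  Subtype.ext (by simpa [cycZeta] using zetaPow_halfTurn k hk)

theorem one_sub_cycZeta_one_dvd (k : ℕ) (t : ZMod (2 ^ k)) :
    1 - cycZeta k 1 ∣ 1 - cycZeta k t := by
  rw [← ZMod.natCast_zmod_val t, cycZeta_natCast]
  exact one_sub_dvd_one_sub_pow _ _

/-- Divisibility by `1 - ζ` is the parity of the coefficient sum. -/
theorem one_sub_cycZeta_one_dvd_iff (k : ℕ) (hk : 1 ≤ k) (x : cycRing k)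
    (a : ZMod (2 ^ k) → ℤ) (hx : (x : ℂ) = cycSum k a) :
    1 - cycZeta k 1 ∣ x ↔ (2 : ℤ) ∣ ∑ t, a t := by
  constructor
  · rintro ⟨⟨_, b, rfl⟩, rfl⟩
    have h : cycSum k a = cycSum k (fun t => b t - b (t - 1)) := by
      rw [← hx]
      have hs : zetaPow k 1 * cycSum k b = cycSum k (fun t => b (t - 1)) := by
        rw [cycSum, Finset.mul_sum, cycSum, ← Equiv.sum_comp (Equiv.subRight (1 : ZMod (2 ^ k)))]
        refine Finset.sum_congr rfl fun t _ => ?_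
        obtain ⟨t, rfl⟩ : ∃ t', t = t' + 1 := ⟨t - 1, (sub_add_cancel t 1).symm⟩
        simp only [Equiv.subRight_apply, add_sub_cancel_right]
        rw [zetaPow_add]
        ring
      change (1 - zetaPow k 1) * cycSum k b = _
      rw [sub_mul, one_mul, hs, ← cycSum_sub]
      rfl
    -- Coefficients are not unique, but two choices differ by an `H`-periodic function, whose total
    -- is even; and the coefficients `b t - b (t - 1)` of a multiple of `1 - ζ` telescope to zero.
    have hd := sub_eq_sub_of_cycSum_eq k hk _ _ h
    have hshift : ∑ t, b (t - 1) = ∑ t, b t := Equiv.sum_comp (Equiv.subRight 1) b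
    have hsum : ∑ t, (a t - (b t - b (t - 1))) = ∑ t, a t := by
      rw [Finset.sum_sub_distrib, Finset.sum_sub_distrib, hshift, sub_self, sub_zero]
    rw [← hsum, sum_eq_sum_range_half k hk]
    refine Finset.dvd_sum fun i _ => ?_
    have := hd (i : ZMod (2 ^ k))
    omega
  · rintro ⟨c, hc⟩
    have h2 : 1 - cycZeta k 1 ∣ (2 : cycRing k) := by
      have := one_sub_cycZeta_one_dvd k (halfTurn k)
      rwa [cycZeta_halfTurn k hk, sub_neg_eq_add, one_add_one_eq_two] at this
    have : x = (∑ t, a t : ℤ) - ∑ t, (a t : cycRing k) * (1 - cycZeta k t) := by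
      apply Subtype.ext
      push_cast
      rw [hx, ← Finset.sum_sub_distrib, cycSum]
      refine Finset.sum_congr rfl fun t _ => ?_
      simp only [cycZeta]
      ring
    rw [this, hc]
    push_cast
    exact dvd_sub (h2.mul_right _) (Finset.dvd_sum fun t _ =>
      (one_sub_cycZeta_one_dvd k t).mul_left _)

/-- The coefficient sum modulo 2 is multiplicative under convolution and its vanishing detects
divisibility by `1 - ζ`, so primality is inherited from the integer 2. -/
theorem prime_one_sub_cycZeta_one (k : ℕ) (hk : 1 ≤ k) : Prime (1 - cycZeta k 1) := by
  refine ⟨?_, ?_, ?_⟩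
  · intro h
    have h1 : zetaPow k 1 = 1 := by
      simpa [cycZeta] using (congrArg Subtype.val (sub_eq_zero.1 h)).symm
    have h2 := zetaPow_halfTurn k hk
    rw [halfTurn, zetaPow_natCast, h1, one_pow] at h2
    norm_num at h2
  · intro h
    have := (one_sub_cycZeta_one_dvd_iff k hk 1 (Pi.single 0 1) (by
      rw [cycSum_single, zetaPow_zero]; simp)).1 h.dvd
    rw [Finset.sum_pi_single'] at this
    simp at this
  · rintro ⟨_, a, rfl⟩ ⟨_, b, rfl⟩ h
    rw [one_sub_cycZeta_one_dvd_iff k hk _ _ (cycSum_mul k a b), Finset.sum_comm] at h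
    have hab : ∑ t, ∑ d, a (d - t) * b t = (∑ t, a t) * ∑ t, b t := by
      rw [Finset.mul_sum]
      refine Finset.sum_congr rfl fun t _ => ?_
      rw [← Finset.sum_mul]
      exact congrArg (· * b t) (Equiv.sum_comp (Equiv.subRight t) a)
    rw [hab] at h
    exact (Int.prime_two.dvd_or_dvd h).imp
      (one_sub_cycZeta_one_dvd_iff k hk _ a rfl).2 (one_sub_cycZeta_one_dvd_iff k hk _ b rfl).2

/-- The prime `2` is totally ramified in `ℤ[ζ]`. -/
theorem associated_two_pow (k : ℕ) (hk : 1 ≤ k) :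
    Associated (2 : cycRing k) ((1 - cycZeta k 1) ^ 2 ^ (k - 1)) := by
  set z := cycZeta k 1 with hz
  have hm : z ^ 2 ^ (k - 1) = -1 := by
    rw [hz, ← cycZeta_natCast]
    exact cycZeta_halfTurn k hk
  -- Induction by `1 - w² = (1 - w)(1 + w)` with `w = z ^ 2 ^ j`, the two factors being associated.
  have key : ∀ j ≤ k - 1, Associated (1 - z ^ 2 ^ j) ((1 - z) ^ 2 ^ j) := by
    intro j
    induction j with
    | zero => intro _; simp
    | succ j ih =>
      intro hj
      have hw : (z ^ 2 ^ j) ^ 2 ^ (k - 1 - j) = -1 := by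
        rw [← pow_mul, ← pow_add, Nat.add_sub_cancel' (by omega), hm]
      obtain ⟨p, hp⟩ : ∃ p, k - 1 - j = p + 1 := ⟨k - 1 - j - 1, by omega⟩
      rw [hp] at hw
      -- As `-1` is an even power of `w`, each of `w` and `-w` is a power of the other, so `1 - w`
      -- and `1 + w` divide each other.
      have hstep : Associated (1 + z ^ 2 ^ j) (1 - z ^ 2 ^ j) := by
        set w := z ^ 2 ^ j
        have h1 : 1 + w = 1 - w ^ (1 + 2 ^ (p + 1)) := by rw [pow_add, hw]; ring
        have h2 : 1 - w = 1 - (-w) ^ (1 + 2 ^ (p + 1)) := by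
          have : (-w) ^ 2 ^ (p + 1) = w ^ 2 ^ (p + 1) :=
            Even.neg_pow (by rw [pow_succ]; exact even_two.mul_left _) w
          rw [pow_add, this, hw]; ring
        refine associated_of_dvd_dvd ?_ ?_
        · rw [h2, show 1 + w = 1 - -w by ring]
          exact one_sub_dvd_one_sub_pow _ _
        · rw [h1]
          exact one_sub_dvd_one_sub_pow _ _
      have : 1 - z ^ 2 ^ (j + 1) = (1 - z ^ 2 ^ j) * (1 + z ^ 2 ^ j) := by
        rw [pow_succ, pow_mul]; ring
      rw [this, pow_succ, pow_mul, sq]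
      exact (ih (by omega)).mul_mul (hstep.trans (ih (by omega)))
  have := key (k - 1) le_rfl
  rwa [hm, sub_neg_eq_add, one_add_one_eq_two] at this

/-- An element of `ℤ[ζ]` of absolute value `2^m` is divisible by `2^m`. -/
theorem two_pow_dvd_of_mul_conj (k : ℕ) (hk : 1 ≤ k) (m : ℕ) (x : cycRing k)
    (hx : x * cycConj k x = 4 ^ m) : (2 : cycRing k) ^ m ∣ x := by
  have hp := prime_one_sub_cycZeta_one k hk
  set p := 1 - cycZeta k 1 with hpdef
  have h2 := associated_two_pow k hk
  have h4 : Associated ((4 : cycRing k) ^ m) (p ^ (2 ^ (k - 1) * m + 2 ^ (k - 1) * m)) := by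
    rw [show (4 : cycRing k) = 2 * 2 by norm_num, mul_pow, pow_add, pow_mul]
    exact (h2.pow_pow).mul_mul h2.pow_pow
  -- Since `1 - ζ⁻¹ = -ζ⁻¹ (1 - ζ)`, an element and its conjugate carry the same power of the prime,
  -- hence half of that in `4^m` each.
  have hpc : Associated (cycConj k p) p := by
    have hinv : cycZeta k (-1) * cycZeta k 1 = 1 := by
      rw [← cycZeta_add, neg_add_cancel]
      exact Subtype.ext (zetaPow_zero k)
    have hc : cycConj k p = 1 - cycZeta k (-1) := by
      rw [hpdef, map_sub, map_one]
      congr 1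
      exact Subtype.ext (conj_zetaPow k 1)
    refine associated_of_dvd_dvd ⟨-cycZeta k 1, ?_⟩ ?_
    · rw [hc, hpdef]
      linear_combination -hinv
    · rw [hc]
      exact one_sub_cycZeta_one_dvd k _
  obtain ⟨i, -, hi⟩ := (dvd_prime_pow hp _).1
    ((Dvd.intro _ hx : x ∣ 4 ^ m).trans h4.dvd)
  have hi' : Associated (cycConj k x) (p ^ i) := by
    have := hi.map (cycConj k)
    rw [map_pow] at this
    exact this.trans hpc.pow_pow
  have hii : Associated (p ^ (i + i)) (p ^ (2 ^ (k - 1) * m + 2 ^ (k - 1) * m)) := by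
    rw [pow_add p i i]
    exact (hi.mul_mul hi').symm.trans (hx ▸ h4)
  have e1 := (pow_dvd_pow_iff hp.ne_zero hp.not_isUnit).1 hii.dvd
  have e2 := (pow_dvd_pow_iff hp.ne_zero hp.not_isUnit).1 hii.symm.dvd
  have : i = 2 ^ (k - 1) * m := by omega
  rw [this, pow_mul] at hi
  exact (h2.pow_pow.trans hi.symm).dvd

/-! ### Coefficients of elements of absolute value `2^m` -/

/-- Elements of absolute value one in `ℤ[ζ]` are powers of `ζ`. -/
theorem exists_sub_eq_of_normSq_cycSum_eq_one (k : ℕ) (hk : 1 ≤ k) (b : ZMod (2 ^ k) → ℤ)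
    (hb : cycSum k b * (starRingEnd ℂ) (cycSum k b) = 1) :
    ∃ s, ∀ t, b t - b (t + halfTurn k) =
      (if t = s then 1 else 0) - if t = s + halfTurn k then 1 else 0 := by
  have hH := halfTurn_add_self k hk
  have hH0 := halfTurn_ne_zero k hk
  set H := halfTurn k
  set d : ZMod (2 ^ k) → ℤ := fun t => b t - b (t + H) with hd
  have hdH : ∀ t, d (t + H) = -d t := by
    intro t
    simp only [hd, add_assoc, hH, add_zero]
    ring
  -- Compare the coefficients of `|∑ b_t ζ^t|² = 1` at 0 and at `H`: the autocorrelation of `b`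
  -- drops by 1 between them, and `∑ d²` is twice that drop.
  have hsum : ∑ t, d t ^ 2 = 2 := by
    have h1 : cycSum k (Pi.single 0 1) = 1 := by rw [cycSum_single, zetaPow_zero]; simp
    rw [conj_cycSum, cycSum_mul, ← h1] at hb
    have h0 := sub_eq_sub_of_cycSum_eq k hk _ _ hb 0
    have hN : ∀ c : ZMod (2 ^ k), ∑ t, b (c - t) * b (-t) = ∑ t, b (t + c) * b t := by
      intro c
      rw [← Equiv.sum_comp (Equiv.neg (ZMod (2 ^ k)))]
      simp [add_comm]
    rw [hN, hN] at h0
    have hr : (Pi.single 0 1 : ZMod (2 ^ k) → ℤ) 0 -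
        (Pi.single 0 1 : ZMod (2 ^ k) → ℤ) (0 + H) = 1 := by
      rw [zero_add, Pi.single_eq_same, Pi.single_eq_of_ne hH0]; norm_num
    change _ = (Pi.single 0 1 : ZMod (2 ^ k) → ℤ) 0 -
        (Pi.single 0 1 : ZMod (2 ^ k) → ℤ) (0 + H) at h0
    rw [hr] at h0
    have hshift : ∑ t, b (t + H) * b (t + H) = ∑ t, b t * b t :=
      Equiv.sum_comp (Equiv.addRight H) fun t => b t * b t
    have : ∑ t, d t ^ 2 = ∑ t, b t * b t + ∑ t, b (t + H) * b (t + H)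
        - 2 * ∑ t, b (t + H) * b t := by
      rw [Finset.mul_sum, ← Finset.sum_add_distrib, ← Finset.sum_sub_distrib]
      refine Finset.sum_congr rfl fun t _ => ?_
      simp only [hd]
      ring
    rw [this, hshift]
    simp only [add_zero, zero_add] at h0
    linarith
  obtain ⟨s, hs⟩ : ∃ s, 0 < d s := by
    by_contra! hneg
    have : ∀ t, d t = 0 := fun t => le_antisymm (hneg t) (by
      have := hneg (t + H); rw [hdH] at this; omega)
    simp [this] at hsum
  refine ⟨s, fun t => ?_⟩
  have hsH : s + H ≠ s := by simpa using hH0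
  change d t = _
  have hone : d s = 1 := by
    -- By antiperiodicity this pair contributes `2 d(s)²`; it exhausts the total 2, leaving nothing
    -- for any other index.
    have h := Finset.sum_le_univ_sum_of_nonneg (s := {s, s + H}) (fun t => sq_nonneg (d t))
    rw [hsum, Finset.sum_pair hsH.symm, hdH] at h
    nlinarith
  by_cases h1 : t = s
  · subst h1
    simp [hone, hsH.symm]
  by_cases h2 : t = s + H
  · subst h2
    simp [hdH, hone, hsH]
  rw [if_neg h1, if_neg h2, sub_zero]
  have h := Finset.sum_le_univ_sum_of_nonneg (s := {t, s, s + H}) (fun t => sq_nonneg (d t))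
  rw [hsum, Finset.sum_insert (by simp [h1, h2]), Finset.sum_pair hsH.symm, hdH, hone] at h
  have : d t ^ 2 ≤ 0 := by linarith
  exact pow_eq_zero_iff (two_ne_zero) |>.1 (le_antisymm this (sq_nonneg _))

/-- The coefficients of a cyclotomic integer of absolute value `2^m`. -/
theorem exists_sub_eq_of_norm_cycSum (k : ℕ) (hk : 1 ≤ k) (m : ℕ) (a : ZMod (2 ^ k) → ℤ)
    (ha : ‖cycSum k a‖ = 2 ^ m) :
    ∃ s, ∀ t, a t - a (t + halfTurn k) =
      2 ^ m * ((if t = s then 1 else 0) - if t = s + halfTurn k then 1 else 0) := by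
  have hn : cycSum k a * (starRingEnd ℂ) (cycSum k a) = 4 ^ m := by
    rw [Complex.mul_conj, Complex.normSq_eq_norm_sq, ha, ← pow_mul, mul_comm m, pow_mul]
    norm_num
  obtain ⟨⟨_, b, rfl⟩, hb⟩ := two_pow_dvd_of_mul_conj k hk m ⟨cycSum k a, a, rfl⟩
    (Subtype.ext hn)
  have hab : cycSum k a = 2 ^ m * cycSum k b := congrArg Subtype.val hb
  have hb1 : cycSum k b * (starRingEnd ℂ) (cycSum k b) = 1 := by
    rw [hab, map_mul, map_pow, show (starRingEnd ℂ) 2 = 2 from Complex.conj_ofNat 2] at hn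
    have h4 : (4 : ℂ) ^ m ≠ 0 := pow_ne_zero _ (by norm_num)
    apply mul_left_cancel₀ h4
    rw [mul_one]
    nth_rewrite 2 [← hn]
    rw [show (4 : ℂ) = 2 * 2 by norm_num, mul_pow]
    ring
  obtain ⟨s, hs⟩ := exists_sub_eq_of_normSq_cycSum_eq_one k hk b hb1
  refine ⟨s, fun t => ?_⟩
  have hab' : cycSum k a = cycSum k (fun t => 2 ^ m * b t) := by
    rw [hab, cycSum, cycSum, Finset.mul_sum]
    push_cast
    exact Finset.sum_congr rfl fun t _ => by ring
  rw [sub_eq_sub_of_cycSum_eq k hk _ _ hab' t, ← mul_sub, hs t]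

/-- If `|∑ a_t ζ^t| = 2^m`, then `|∑ a_t F(t)| = 2^m` for every antiperiodic unimodular `F`. -/
theorem norm_sum_antiperiodic (k : ℕ) (hk : 1 ≤ k) (m : ℕ) (a : ZMod (2 ^ k) → ℤ)
    (ha : ‖cycSum k a‖ = 2 ^ m) (F : ZMod (2 ^ k) → ℂ) (hF : ∀ t, F (t + halfTurn k) = -F t)
    (hF1 : ∀ t, ‖F t‖ = 1) : ‖∑ t, (a t : ℂ) * F t‖ = 2 ^ m := by
  obtain ⟨s, hs⟩ := exists_sub_eq_of_norm_cycSum k hk m a ha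
  have h1 : ∑ t, (a (t + halfTurn k) : ℂ) * F t = -∑ t, (a t : ℂ) * F t := by
    rw [← Equiv.sum_comp (Equiv.addRight (halfTurn k)) fun t => (a t : ℂ) * F t,
      ← Finset.sum_neg_distrib]
    refine Finset.sum_congr rfl fun t _ => ?_
    simp [hF]
  have h2 : ∑ t, ((a t - a (t + halfTurn k) : ℤ) : ℂ) * F t = 2 * ∑ t, (a t : ℂ) * F t := by
    push_cast
    simp_rw [sub_mul]
    rw [Finset.sum_sub_distrib, h1]
    ring
  have h3 : ∑ t, ((a t - a (t + halfTurn k) : ℤ) : ℂ) * F t = 2 * (2 ^ m * F s) := by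
    simp_rw [hs]
    push_cast
    simp_rw [mul_sub, sub_mul, mul_assoc]
    rw [Finset.sum_sub_distrib, ← Finset.mul_sum, ← Finset.mul_sum]
    simp [hF]
    ring
  have h4 : ∑ t, (a t : ℂ) * F t = 2 ^ m * F s := by
    have := h2.symm.trans h3
    exact mul_left_cancel₀ two_ne_zero this
  rw [h4, norm_mul, hF1, mul_one]
  simp

/-! ### Characters of `𝔽₂^m` and Parseval -/

theorem neg_one_pow_val_add (a b : ZMod 2) :
    (-1 : ℂ) ^ (a + b).val = (-1) ^ a.val * (-1) ^ b.val := by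
  revert a b
  have h : ∀ a b : ZMod 2, (a + b).val % 2 = (a.val + b.val) % 2 := by decide
  intro a b
  rw [← pow_add, neg_one_pow_eq_pow_mod_two, h, ← neg_one_pow_eq_pow_mod_two]

theorem neg_one_pow_val_sum {ι : Type*} (s : Finset ι) (a : ι → ZMod 2) :
    (-1 : ℂ) ^ (∑ i ∈ s, a i).val = ∏ i ∈ s, (-1) ^ (a i).val := by
  classical
  induction s using Finset.induction_on with
  | empty => simp
  | insert i s hi ih => rw [Finset.sum_insert hi, Finset.prod_insert hi, neg_one_pow_val_add, ih]

theorem ZMod.sum_univ_two {M : Type*} [AddCommMonoid M] (f : ZMod 2 → M) :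
    ∑ t, f t = f 0 + f 1 := Fin.sum_univ_two f

/-- Orthogonality of the characters of `𝔽₂^m`. -/
theorem sum_neg_one_pow_dot {m : ℕ} (w : Fin m → ZMod 2) :
    ∑ v : Fin m → ZMod 2, (-1 : ℂ) ^ (∑ i, v i * w i).val = if w = 0 then 2 ^ m else 0 := by
  simp_rw [neg_one_pow_val_sum]
  rw [← Fintype.prod_sum fun i (t : ZMod 2) => (-1 : ℂ) ^ (t * w i).val]
  simp_rw [ZMod.sum_univ_two]
  split_ifs with h
  · subst h
    simp [one_add_one_eq_two]
  · obtain ⟨i, hi⟩ := Function.ne_iff.1 h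
    refine Finset.prod_eq_zero (Finset.mem_univ i) ?_
    have : w i = 1 := by
      have : ∀ a : ZMod 2, a ≠ 0 → a = 1 := by decide
      exact this _ hi
    simp [this, ZMod.val_one]

/-- Parseval's identity on `𝔽₂^m`. -/
theorem sum_normSq_walsh {m : ℕ} (A : (Fin m → ZMod 2) → ℂ) :
    ∑ v : Fin m → ZMod 2, ‖∑ y, A y * (-1 : ℂ) ^ (∑ i, v i * y i).val‖ ^ 2 =
      2 ^ m * ∑ y, ‖A y‖ ^ 2 := by
  have hc : ∀ z : ℂ, ((‖z‖ ^ 2 : ℝ) : ℂ) = z * (starRingEnd ℂ) z := by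
    intro z
    rw [Complex.mul_conj, Complex.normSq_eq_norm_sq]
  apply Complex.ofReal_injective
  rw [Complex.ofReal_sum, Complex.ofReal_mul, Complex.ofReal_sum]
  simp_rw [hc, map_sum, map_mul, map_pow, map_neg, map_one, Finset.sum_mul_sum]
  rw [Finset.sum_comm, Complex.ofReal_pow, Complex.ofReal_ofNat, Finset.mul_sum]
  refine Finset.sum_congr rfl fun y _ => ?_
  rw [Finset.sum_comm, Finset.sum_eq_single y]
  · have : ∀ v : Fin m → ZMod 2, A y * (-1 : ℂ) ^ (∑ i, v i * y i).val *
        ((starRingEnd ℂ) (A y) * (-1) ^ (∑ i, v i * y i).val) = A y * (starRingEnd ℂ) (A y) := by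
      intro v
      rw [mul_mul_mul_comm, ← mul_pow, neg_one_mul, neg_neg, one_pow, mul_one]
    simp [this]
  · intro y' _ hy
    have : ∀ v : Fin m → ZMod 2, A y * (-1 : ℂ) ^ (∑ i, v i * y i).val *
        ((starRingEnd ℂ) (A y') * (-1) ^ (∑ i, v i * y' i).val) =
        A y * (starRingEnd ℂ) (A y') * (-1) ^ (∑ i, v i * (y + y') i).val := by
      intro v
      rw [mul_mul_mul_comm, ← neg_one_pow_val_add, ← Finset.sum_add_distrib]
      simp [mul_add]
    simp_rw [this]
    rw [← Finset.mul_sum, sum_neg_one_pow_dot, if_neg, mul_zero]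
    intro h0
    apply hy
    have h2 : ∀ a b : ZMod 2, a + b = 0 → b = a := by decide
    exact funext fun i => h2 _ _ (congrFun h0 i)
  · simp

/-! ### Degeneracy of gbent functions of the given form -/

theorem sum_pi_sum_type {α β : Type} [Fintype α] [Fintype β] [DecidableEq α] [DecidableEq β]
    (F : (α ⊕ β → ZMod 2) → ℂ) : ∑ z, F z = ∑ y, ∑ x, F (Sum.elim x y) := by
  rw [← (Equiv.sumArrowEquivProdArrow α β (ZMod 2)).symm.sum_comp, Fintype.sum_prod_type_right]
  rfl

/-- For fixed `y` the integer `N` is a sum of terms in separate bits `x_i`, so the exponential sum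
factors. -/
theorem zetaPow_mmInt_sum {m k : ℕ} (π : Equiv.Perm (Fin m → ZMod 2)) (y : Fin m → ZMod 2) :
    ∑ x, zetaPow k (mmInt π x y : ZMod (2 ^ k)) = ∏ i, (1 + zetaPow k 1 ^ (π y i).val) := by
  have h : ∀ x : Fin m → ZMod 2, zetaPow k (mmInt π x y : ZMod (2 ^ k)) =
      ∏ i, (zetaPow k 1 ^ (π y i).val) ^ (x i).val := by
    intro x
    rw [zetaPow_natCast, mmInt, ← Finset.prod_pow_eq_pow_sum]
    exact Finset.prod_congr rfl fun i _ => by rw [← pow_mul, mul_comm]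
  simp_rw [h]
  rw [← Fintype.prod_sum fun i (t : ZMod 2) => (zetaPow k 1 ^ (π y i).val) ^ t.val]
  simp_rw [ZMod.sum_univ_two]
  simp [ZMod.val_one]

/-- For `k ≥ 2` and `m ≥ 1` the function `x ⬝ π(y) + g(y)` is never gbent. -/
theorem eq_zero_of_isGbent_mmFun {m k : ℕ} (hk : 2 ≤ k) (π : Equiv.Perm (Fin m → ZMod 2))
    (g : (Fin m → ZMod 2) → ZMod (2 ^ k)) (hf : IsGbent (mmFun π g)) : m = 0 := by
  by_contra hm
  set P : (Fin m → ZMod 2) → ℂ := fun y => ∏ i, (1 + zetaPow k 1 ^ (π y i).val) with hP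
  have hW : ∀ v : Fin m → ZMod 2, WHT (mmFun π g) (Sum.elim 0 v) =
      ∑ y, zetaPow k (g y) * P y * (-1 : ℂ) ^ (∑ i, v i * y i).val := by
    intro v
    rw [WHT, sum_pi_sum_type]
    refine Finset.sum_congr rfl fun y _ => ?_
    simp only [hP]
    rw [← zetaPow_mmInt_sum, Finset.mul_sum, Finset.sum_mul]
    refine Finset.sum_congr rfl fun x _ => ?_
    simp only [mmFun, zetaPow_add, Fintype.sum_sum_type, Sum.elim_inl, Sum.elim_inr,
      Pi.zero_apply, zero_mul, Finset.sum_const_zero, zero_add]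
    ring
  have hpars := sum_normSq_walsh fun y => zetaPow k (g y) * P y
  have hf' : ∀ v : Fin m → ZMod 2, ‖WHT (mmFun π g) (Sum.elim 0 v)‖ =
      (2 : ℝ) ^ ((Fintype.card (Fin m ⊕ Fin m) : ℝ) / 2) := fun v => hf _
  simp_rw [← hW, hf', norm_mul, norm_zetaPow, one_mul] at hpars
  have hcard : ((2 : ℝ) ^ ((Fintype.card (Fin m ⊕ Fin m) : ℝ) / 2)) ^ 2 = 4 ^ m := by
    rw [← Real.rpow_natCast, ← Real.rpow_mul (by norm_num)]
    simp only [Fintype.card_sum, Fintype.card_fin]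
    push_cast
    rw [show ((m : ℝ) + m) / 2 * 2 = ((2 * m : ℕ) : ℝ) by push_cast; ring, Real.rpow_natCast,
      pow_mul]
    norm_num
  rw [hcard, Finset.sum_const, Finset.card_univ, nsmul_eq_mul] at hpars
  simp only [Fintype.card_pi, ZMod.card, Finset.prod_const, Finset.card_univ, Fintype.card_fin,
    Nat.cast_pow, Nat.cast_ofNat] at hpars
  have hsum : (4 : ℝ) ^ m = ∑ y, ‖P y‖ ^ 2 := mul_left_cancel₀ (by positivity) hpars
  have h01 : π.symm 0 ≠ π.symm 1 := by
    rw [Ne, π.symm.injective.eq_iff]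
    intro h
    have := congrFun h ⟨0, by omega⟩
    simp at this
  have h0 : ‖P (π.symm 0)‖ ^ 2 = 4 ^ m := by
    simp only [hP, Equiv.apply_symm_apply, Pi.zero_apply, ZMod.val_zero, pow_zero,
      Finset.prod_const, Finset.card_univ, Fintype.card_fin, norm_pow]
    rw [← pow_mul, mul_comm, pow_mul, one_add_one_eq_two]
    norm_num
  have h1 : 0 < ‖P (π.symm 1)‖ ^ 2 := by
    -- Here `k ≥ 2` enters: `ζ = -1` happens only for `k = 1`.
    have hne : 1 + zetaPow k 1 ≠ 0 := by
      intro h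
      have h2 : zetaPow k 1 ^ 2 = 1 := by
        rw [eq_neg_of_add_eq_zero_right h]; norm_num
      have h3 := (isPrimitiveRoot_zetaPow_one k).dvd_of_pow_eq_one 2 h2
      have h4 := Nat.le_of_dvd (by norm_num) h3
      have h5 : 2 ^ 2 ≤ 2 ^ k := Nat.pow_le_pow_right (by norm_num) hk
      omega
    have : P (π.symm 1) ≠ 0 := by
      simp only [hP, Equiv.apply_symm_apply, Pi.one_apply, ZMod.val_one, pow_one]
      exact Finset.prod_ne_zero_iff.2 fun _ _ => hne
    positivity
  have h := Finset.sum_le_univ_sum_of_nonneg (s := {π.symm 0, π.symm 1})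
    (fun y => sq_nonneg ‖P y‖)
  rw [← hsum, Finset.sum_pair h01, h0] at h
  linarith

/-! ### Derived functions and levels -/

theorem norm_rpow_card_sum (m : ℕ) :
    (2 : ℝ) ^ ((Fintype.card (Fin m ⊕ Fin m) : ℝ) / 2) = 2 ^ m := by
  simp only [Fintype.card_sum, Fintype.card_fin]
  push_cast
  rw [add_self_div_two, Real.rpow_natCast]

/-- The Walsh transform of `Φ ∘ h` in terms of the fibres of `h`. -/
theorem WHT_comp {ι : Type} [Fintype ι] [DecidableEq ι] {k l : ℕ}
    (h : (ι → ZMod 2) → ZMod (2 ^ k)) (Φ : ZMod (2 ^ k) → ZMod (2 ^ l)) (u : ι → ZMod 2) :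
    WHT (fun z => Φ (h z)) u = ∑ t, ((∑ x with h x = t, (-1 : ℤ) ^ (∑ i, u i * x i).val : ℤ) : ℂ) *
      zetaPow l (Φ t) := by
  rw [WHT, ← Finset.sum_fiberwise Finset.univ h]
  refine Finset.sum_congr rfl fun t _ => ?_
  push_cast
  rw [Finset.sum_mul]
  refine Finset.sum_congr rfl fun x hx => ?_
  rw [(Finset.mem_filter.1 hx).2, mul_comm]

/-- The composition of a gbent function with an antiperiodic map is gbent. -/
theorem IsGbent.comp {m k l : ℕ} (hk : 1 ≤ k) (hl : 1 ≤ l)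
    {h : (Fin m ⊕ Fin m → ZMod 2) → ZMod (2 ^ k)} (hh : IsGbent h)
    (Φ : ZMod (2 ^ k) → ZMod (2 ^ l)) (hΦ : ∀ t, Φ (t + halfTurn k) = Φ t + halfTurn l) :
    IsGbent fun z => Φ (h z) := by
  intro u
  have hu := hh u
  rw [norm_rpow_card_sum] at hu ⊢
  rw [WHT_comp]
  refine norm_sum_antiperiodic k hk m _ ?_ (fun t => zetaPow l (Φ t)) ?_ ?_
  · rw [← hu, cycSum]
    -- With `Φ = id` the fibre sums are the coefficients of the Walsh value of `h` itself.
    exact congrArg norm (WHT_comp h id u).symm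
  · intro t
    rw [hΦ, zetaPow_add_halfTurn l hl]
  · intro t
    exact norm_zetaPow l _

theorem IsGbent.derivedFun {m ℓ r : ℕ} (hℓ : 1 ≤ ℓ) (hr : 1 ≤ r)
    {h : (Fin m ⊕ Fin m → ZMod 2) → ZMod (2 ^ (ℓ * r))} (hh : IsGbent h)
    (β : Fin (r - 1) → ZMod (2 ^ ℓ)) : IsGbent (derivedFun ℓ r h β) :=
  hh.comp (Nat.mul_pos hℓ hr) hℓ (_root_.derivedFun ℓ r id β)
    (derivedFun_id_add_half ℓ r hℓ hr β)

/-- A gbent function of `2m` variables has the single level `(2m, 1)`. -/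
theorem IsGbent.isLandscapeWithLevels {m k : ℕ} {h : (Fin m ⊕ Fin m → ZMod 2) → ZMod (2 ^ k)}
    (hh : IsGbent h) : IsLandscapeWithLevels h {(2 * m, 1)} := by
  refine ⟨Finset.singleton_nonempty _, by simp, ?_⟩
  have hu : ∀ u, ‖WHT h u‖ = 2 ^ m := fun u => (hh u).trans (norm_rpow_card_sum m)
  have hsupp : Function.support (WHT h) = Set.univ := by
    refine Set.eq_univ_of_forall fun u h0 => ?_
    have := hu u
    rw [h0, norm_zero] at this
    exact absurd this (by positivity)
  simp only [hu, hsupp, Finset.coe_singleton, Set.image_singleton]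
  rw [Set.image_univ, Set.range_const]
  push_cast
  rw [mul_div_cancel_left₀ _ (two_ne_zero' ℝ), Real.rpow_natCast, mul_one]

theorem mainTheorem11 (m ℓ r : ℕ) (hℓ : 1 ≤ ℓ) (hr : 1 ≤ r)
    (π : Equiv.Perm (Fin m → ZMod 2)) (g : (Fin m → ZMod 2) → ZMod (2 ^ (ℓ * r))) :
    -- (i) the components are well defined: they form the unique `2^ℓ`-adic decomposition
    (IsAdicDecomposition ℓ r (mmFun π g) (fun j => adicComponent ℓ (mmFun π g) j) ∧
      ∀ c, IsAdicDecomposition ℓ r (mmFun π g) c →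
        c = fun j : Fin r => adicComponent ℓ (mmFun π g) j) ∧
    (IsAdicDecomposition ℓ r g (fun j => adicComponent ℓ g j) ∧
      ∀ c, IsAdicDecomposition ℓ r g c → c = fun j : Fin r => adicComponent ℓ g j) ∧
    -- they are the digits of the integer `N(x, y) + g(y)`
    (∀ j < r, ∀ x y : Fin m → ZMod 2,
      adicComponent ℓ (mmFun π g) j (Sum.elim x y) = adicDigit ℓ j (mmInt π x y + (g y).val)) ∧
    -- digit formula with inter-block carries
    (∀ j < r, ∀ x y : Fin m → ZMod 2,
      adicComponent ℓ (mmFun π g) j (Sum.elim x y) =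
        adicDigit ℓ j (mmInt π x y) + adicComponent ℓ g j y +
          (blockCarry ℓ (fun i => adicDigit ℓ i (mmInt π x y))
            (fun i => adicComponent ℓ g i y) j : ZMod (2 ^ ℓ))) ∧
    -- the carry is given by the preceding block alone exactly when no carry runs through it
    (∀ j, j + 1 < r → ∀ x y : Fin m → ZMod 2,
      (adicComponent ℓ (mmFun π g) (j + 1) (Sum.elim x y) =
        adicDigit ℓ (j + 1) (mmInt π x y) + adicComponent ℓ g (j + 1) y +
          ((((adicDigit ℓ j (mmInt π x y)).val + (adicComponent ℓ g j y).val) / 2 ^ ℓ : ℕ) :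
            ZMod (2 ^ ℓ))) ↔
      ¬ (blockCarry ℓ (fun i => adicDigit ℓ i (mmInt π x y))
            (fun i => adicComponent ℓ g i y) j = 1 ∧
          (adicDigit ℓ j (mmInt π x y)).val + (adicComponent ℓ g j y).val = 2 ^ ℓ - 1)) ∧
    -- and this is always so if `f` is gbent
    (IsGbent (mmFun π g) → ∀ j, j + 1 < r → ∀ x y : Fin m → ZMod 2,
      adicComponent ℓ (mmFun π g) (j + 1) (Sum.elim x y) =
        adicDigit ℓ (j + 1) (mmInt π x y) + adicComponent ℓ g (j + 1) y +
          ((((adicDigit ℓ j (mmInt π x y)).val + (adicComponent ℓ g j y).val) / 2 ^ ℓ : ℕ) :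
            ZMod (2 ^ ℓ))) ∧
    -- (ii) derived functions of `f`
    (IsGbent (mmFun π g) → ∃ L : Finset (ℕ × ℕ), IsLandscapeWithLevels (mmFun π g) L ∧
      ∀ β : Fin (r - 1) → ZMod (2 ^ ℓ),
        IsLandscapeWithLevels (derivedFun ℓ r (mmFun π g) β) L ∧
          IsGbent (derivedFun ℓ r (mmFun π g) β)) ∧
    -- (ii) for every gbent function on `𝔽₂^{2m}`, of this form or not
    (∀ h : (Fin m ⊕ Fin m → ZMod 2) → ZMod (2 ^ (ℓ * r)), IsGbent h →
      ∃ L : Finset (ℕ × ℕ), IsLandscapeWithLevels h L ∧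
        ∀ β : Fin (r - 1) → ZMod (2 ^ ℓ),
          IsLandscapeWithLevels (derivedFun ℓ r h β) L ∧ IsGbent (derivedFun ℓ r h β)) := by
  have hlevels : ∀ h : (Fin m ⊕ Fin m → ZMod 2) → ZMod (2 ^ (ℓ * r)), IsGbent h →
      ∃ L : Finset (ℕ × ℕ), IsLandscapeWithLevels h L ∧
        ∀ β : Fin (r - 1) → ZMod (2 ^ ℓ),
          IsLandscapeWithLevels (derivedFun ℓ r h β) L ∧ IsGbent (derivedFun ℓ r h β) :=
    fun h hh => ⟨{(2 * m, 1)}, hh.isLandscapeWithLevels, fun β =>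
      ⟨(hh.derivedFun hℓ hr β).isLandscapeWithLevels, hh.derivedFun hℓ hr β⟩⟩
  have hdigit : ∀ j < r, ∀ x y : Fin m → ZMod 2,
      adicComponent ℓ (mmFun π g) j (Sum.elim x y) =
        adicDigit ℓ j (mmInt π x y) + adicComponent ℓ g j y +
          (blockCarry ℓ (fun i => adicDigit ℓ i (mmInt π x y))
            (fun i => adicComponent ℓ g i y) j : ZMod (2 ^ ℓ)) := fun j hj x y =>
    (adicComponent_mmFun π g j hj x y).trans (adicDigit_add ℓ _ _ j)
  have hiff : ∀ j, j + 1 < r → ∀ x y : Fin m → ZMod 2,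
      (adicComponent ℓ (mmFun π g) (j + 1) (Sum.elim x y) =
        adicDigit ℓ (j + 1) (mmInt π x y) + adicComponent ℓ g (j + 1) y +
          ((((adicDigit ℓ j (mmInt π x y)).val + (adicComponent ℓ g j y).val) / 2 ^ ℓ : ℕ) :
            ZMod (2 ^ ℓ))) ↔
      ¬ (blockCarry ℓ (fun i => adicDigit ℓ i (mmInt π x y))
            (fun i => adicComponent ℓ g i y) j = 1 ∧
          (adicDigit ℓ j (mmInt π x y)).val + (adicComponent ℓ g j y).val = 2 ^ ℓ - 1) := by
    intro j hj x y
    rw [hdigit (j + 1) hj x y, add_right_inj]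
    exact cast_div_eq_cast_blockCarry_succ_iff ℓ hℓ _ _ j
  refine ⟨⟨isAdicDecomposition_adicComponent ℓ r _, fun c hc => hc.eq_adicComponent⟩,
    ⟨isAdicDecomposition_adicComponent ℓ r _, fun c hc => hc.eq_adicComponent⟩,
    adicComponent_mmFun π g, hdigit, hiff, ?_, hlevels _, hlevels⟩
  intro hf j hj x y
  -- A second block exists, so `k ≥ 2` and the gbent hypothesis forces `m = 0`; then `N` is an empty
  -- sum.
  have hk : 2 ≤ ℓ * r := (show 2 ≤ r by omega).trans (Nat.le_mul_of_pos_left r hℓ)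
  obtain rfl := eq_zero_of_isGbent_mmFun hk π g hf
  refine (hiff j hj x y).2 fun h => ?_
  have hzero : (fun i => adicDigit ℓ i (mmInt π x y)) = fun _ => 0 := by
    funext i
    simp [mmInt, adicDigit]
  rw [hzero, blockCarry_zero_left] at h
  exact zero_ne_one h.1
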